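/- A network is a finite directed acyclic graph with unit-capacity edges, in which the (non-empty) set of sources and the set of terminals are disjoint, no edge enters a source and no edge leaves a terminal; each source generates one message, and each terminal demands the messages of a set of sources. The network is multiple-unicast if each terminal demands exactly one message and each message is demanded by exactly one terminal. Let $F$ be a finite field and $k,n\ge 1$. In a $(k,n)$ fractional linear network code over $F$, every source $s$ generates a vector $X_s\in F^k$, and every edge $e$ carries a vector $Y_e\in F^n$, where $Y_e=A_{s,e}X_s$ with $A_{s,e}\in F^{n\times k}$ if $e$ leaves a source $s$, and $Y_e=\sum_{e'\in \mathrm{In}(v)}A_{e',e}Y_{e'}$ with $A_{e',e}\in F^{n\times n}$ if $e$ leaves a non-source node $v$; here $\mathrm{In}(v)$ is the set of edges ending at $v$. It is a $(k,n)$ fractional linear network coding solution if there are decoding matrices $B_{t,s,e}\in F^{k\times n}$ such that $X_s=\sum_{e\in \mathrm{In}(t)}B_{t,s,e}Y_e$ for every terminal $t$, every source $s$ whose message $t$ demands, and every choice of the messages. A network has a rate $k/n$ fractional linear network coding solution over $F$ if it has a $(dk,dn)$ fractional linear network coding solution over $F$ for some integer $d\ge 1$. **Theorem.** Let $k,n$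 be positive integers and let $S$ be a set of primes that is finite or co-finite (in the set of all primes). Then there is a multiple-unicast network $\mathcal N$ such that, for every finite field $F$, $\mathcal N$ has a rate $k/n$ fractional linear network coding solution over $F$ if and only if the characteristic of $F$ belongs to $S$. Moreover, $\mathcal N$ can be chosen so that, in addition, for every finite field $F$, $\mathcal N$ has a $(dk,dn)$ fractional linear network coding solution over $F$ for every integer $d\ge 1$ if and only if the characteristic of $F$ belongs to $S$. -/

import Mathlib

open scoped Matrix

/-- A network: a finite directed acyclic graph whose edges have unit capacity, with a
non-empty set of sources (no incoming edges, one message each) and a set of terminals (no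
outgoing edges), where each terminal demands the messages of a set of sources. -/
structure Network where
  /-- the nodes -/
  V : Type
  /-- the edges -/
  E : Type
  [fintypeV : Fintype V]
  [fintypeE : Fintype E]
  tail : E → V
  head : E → V
  /-- an edge is determined by its end points: `e` is the pair `(tail e, head e)` -/
  edge_ext : ∀ e e' : E, tail e = tail e' → head e = head e' → e = e'
  /-- there is no directed cycle -/
  acyclic : ∀ v : V, ¬ Relation.TransGen (fun u w => ∃ e : E, tail e = u ∧ head e = w) v v
  sources : Finset V
  terminals : Finset V
  sources_nonempty : sources.Nonempty
  disjoint_sources_terminals : Disjoint sources terminals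
  head_notMem_sources : ∀ e : E, head e ∉ sources
  tail_notMem_terminals : ∀ e : E, tail e ∉ terminals
  /-- the sources whose messages a terminal demands (only its values at terminals matter) -/
  demand : V → Finset V
  demand_subset : ∀ t ∈ terminals, demand t ⊆ sources

namespace Network

attribute [instance] Network.fintypeV Network.fintypeE

open Classical in
/-- The set of edges that end at the node `v`. -/
noncomputable def inEdges (N : Network) (v : N.V) : Finset N.E :=
  Finset.univ.filter (fun e => N.head e = v)

/-- Each terminal demands exactly one message, and each message is demanded by exactly
one terminal. -/
def IsMultipleUnicast (N : Network) : Prop :=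
  (∀ t ∈ N.terminals, ∃ s ∈ N.sources, N.demand t = {s}) ∧
    ∀ s ∈ N.sources, ∃! t, t ∈ N.terminals ∧ s ∈ N.demand t

/-- The local coding matrices of a `(k, n)` fractional linear network code over `F`.
Only the entries for edges `e` leaving a source, for consecutive edges `e'`, `e`, and for edges
entering a terminal that demands `s` are ever used. -/
structure FractionalCode (N : Network) (F : Type*) [Field F] (k n : ℕ) where
  /-- `ofSource e` multiplies the message of the source `tail e` -/
  ofSource : N.E → Matrix (Fin n) (Fin k) F
  /-- `ofEdge e' e` multiplies the information on `e'` as it is passed on to `e` -/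
  ofEdge : N.E → N.E → Matrix (Fin n) (Fin n) F
  /-- `decode t s e` multiplies the information on `e` when `t` computes the message of `s` -/
  decode : N.V → N.V → N.E → Matrix (Fin k) (Fin n) F

/-- `Y` is the information carried by the edges when the source `s` emits the message `X s`
(the values of `X` outside the sources play no role). -/
def FractionalCode.Carries {N : Network} {F : Type*} [Field F] {k n : ℕ}
    (C : N.FractionalCode F k n) (X : N.V → Fin k → F) (Y : N.E → Fin n → F) : Prop :=
  ∀ e : N.E,
    (N.tail e ∈ N.sources → Y e = C.ofSource e *ᵥ X (N.tail e)) ∧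
    (N.tail e ∉ N.sources → Y e = ∑ e' ∈ N.inEdges (N.tail e), C.ofEdge e' e *ᵥ Y e')

/-- The network has a `(k, n)` fractional linear network coding solution over `F`. -/
def HasFractionalSolution (N : Network) (F : Type*) [Field F] (k n : ℕ) : Prop :=
  ∃ C : N.FractionalCode F k n, ∀ X : N.V → Fin k → F, ∃ Y : N.E → Fin n → F,
    C.Carries X Y ∧
      ∀ t ∈ N.terminals, ∀ s ∈ N.demand t,
        X s = ∑ e ∈ N.inEdges t, C.decode t s e *ᵥ Y e

/-- The network has a rate `k / n` fractional linear network coding solution over `F`. -/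
def HasRateSolution (N : Network) (F : Type*) [Field F] (k n : ℕ) : Prop :=
  ∃ d : ℕ, 0 < d ∧ N.HasFractionalSolution F (d * k) (d * n)

end Network

/-!
Let every message be split among `n` sources, and let a bottleneck consist of `k` parallel edges.
In a `(dk, dn)` code a message and a bottleneck then have the same dimension `dkn`, so a bottleneck
from which a message can be recovered is completely filled by it. Take messages `x i` for `i : ι`,
a bottleneck entered by all of them and, for every `i`, one entered by those other than `x i`, and
ask for `x i` to be recovered from these two bottlenecks. Up to a change of coordinates in every
message, the contents have to be `∑ j, x j` and `∑ j, x j - x i`, over any field.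

Let `q + 1` be the number of the `x i`. The sums `∑ j, x j - x i` add up to `q • ∑ j, x j`, so they
determine `∑ j, x j` if and only if `q ≠ 0` in the field; similarly, `∑ j, x j` and all but one of
the sums `∑ j, x j - x i` determine the remaining one if and only if `q = 0`. Such a
dependence is forced by one more message which enters only the bottleneck in question and has to be
recovered from it and from the bottlenecks that should determine its content. Choosing `q` as a
product of primes gives all finite and co-finite sets.
-/

section LinearAlgebra

theorem exists_linearMap_forall_prodMk_mem {R A B : Type*} [Semiring R] [AddCommMonoid A]
    [Module R A] [Module.Projective R A] [AddCommMonoid B] [Module R B] (G : Submodule R (A × B))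
    (hG : ∀ x, ∃ y, (x, y) ∈ G) : ∃ g : A →ₗ[R] B, ∀ x, (x, g x) ∈ G := by
  have hsurj : (LinearMap.fst R A B ∘ₗ G.subtype).range = ⊤ :=
    LinearMap.range_eq_top.2 fun x => (hG x).elim fun y hy => ⟨⟨(x, y), hy⟩, rfl⟩
  obtain ⟨r, hr⟩ := LinearMap.exists_rightInverse_of_surjective _ hsurj
  have hfst (x : A) : (r x).1.1 = x := LinearMap.congr_fun hr x
  refine ⟨LinearMap.snd R A B ∘ₗ G.subtype ∘ₗ r, fun x => ?_⟩
  convert (r x).2 using 1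
  exact Prod.ext (hfst x).symm rfl

variable {F A B C : Type*} [DivisionRing F] [AddCommGroup A] [Module F A] [AddCommGroup B]
  [Module F B] [AddCommGroup C] [Module F C]

theorem exists_comp_eq_of_ker_le_ker (h : A →ₗ[F] B) (g : A →ₗ[F] C) (hle : h.ker ≤ g.ker) :
    ∃ G : B →ₗ[F] C, G ∘ₗ h = g := by
  obtain ⟨G, hG⟩ := LinearMap.exists_extend
    (h.ker.liftQ g hle ∘ₗ h.quotKerEquivRange.symm.toLinearMap)
  refine ⟨G, LinearMap.ext fun x => ?_⟩
  have := LinearMap.congr_fun hG (h.rangeRestrict x)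
  have hx : h.quotKerEquivRange.symm (h.rangeRestrict x) = h.ker.mkQ x :=
    h.quotKerEquivRange_symm_apply_image x (h.rangeRestrict x).2
  simpa [hx] using this

theorem exists_eq_sum_comp_of_forall_eq_zero {ι : Type*} (s : Finset ι) (h : ι → A →ₗ[F] B)
    (g : A →ₗ[F] C) (hg : ∀ x, (∀ i ∈ s, h i x = 0) → g x = 0) :
    ∃ G : ι → B →ₗ[F] C, ∀ x, g x = ∑ i ∈ s, G i (h i x) := by
  classical
  obtain ⟨G, hG⟩ := exists_comp_eq_of_ker_le_ker (LinearMap.pi fun i : s => h i) g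
    fun x hx => hg x fun i hi => congrFun hx ⟨i, hi⟩
  refine ⟨fun i => if hi : i ∈ s then G ∘ₗ LinearMap.single F (fun _ => B) ⟨i, hi⟩ else 0,
    fun x => ?_⟩
  calc g x = G fun i : s => h i x := (LinearMap.congr_fun hG x).symm
    _ = ∑ i : s, G (Pi.single i (h i x)) := by
      rw [← map_sum, Finset.univ_sum_single]
    _ = _ := by
      rw [← Finset.sum_coe_sort s]
      exact Finset.sum_congr rfl fun i _ => by simp

end LinearAlgebra

namespace Network

/-- The global form of a linear solution: `Y e X` is the content of the edge `e` when the messages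
are `X`. Instead of coding matrices, only the kernels are recorded: the content of an edge, and a
demanded message, have to vanish whenever the data they are computed from vanish. -/
structure IsGlobalSolution (N : Network) {R W U : Type*} [Semiring R] [AddCommMonoid W]
    [Module R W] [AddCommMonoid U] [Module R U] (Y : N.E → (N.V → W) →ₗ[R] U) : Prop where
  source : ∀ e X, N.tail e ∈ N.sources → X (N.tail e) = 0 → Y e X = 0
  relay : ∀ e X, N.tail e ∉ N.sources → (∀ e', N.head e' = N.tail e → Y e' X = 0) → Y e X = 0
  decode : ∀ t ∈ N.terminals, ∀ s ∈ N.demand t, ∀ X, (∀ e, N.head e = t → Y e X = 0) → X s = 0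

variable {N : Network} {F : Type*} [Field F] {k n : ℕ}

@[simp]
theorem mem_inEdges {v : N.V} {e : N.E} : e ∈ N.inEdges v ↔ N.head e = v := by
  simp [inEdges]

/-- The pairs of messages and edge contents that satisfy the coding and decoding equations. -/
def FractionalCode.solutions (C : N.FractionalCode F k n) :
    Submodule F ((N.V → Fin k → F) × (N.E → Fin n → F)) where
  carrier := {p | C.Carries p.1 p.2 ∧ ∀ t ∈ N.terminals, ∀ s ∈ N.demand t,
    p.1 s = ∑ e ∈ N.inEdges t, C.decode t s e *ᵥ p.2 e}
  zero_mem' := by simp [Carries]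
  add_mem' := by
    rintro p p' ⟨hp, hpd⟩ ⟨hp', hpd'⟩
    refine ⟨fun e => ⟨fun he => ?_, fun he => ?_⟩, fun t ht s hs => ?_⟩
    · simp [(hp e).1 he, (hp' e).1 he, Matrix.mulVec_add]
    · simp [(hp e).2 he, (hp' e).2 he, Matrix.mulVec_add, Finset.sum_add_distrib]
    · simp [hpd t ht s hs, hpd' t ht s hs, Matrix.mulVec_add, Finset.sum_add_distrib]
  smul_mem' := by
    rintro a p ⟨hp, hpd⟩
    refine ⟨fun e => ⟨fun he => ?_, fun he => ?_⟩, fun t ht s hs => ?_⟩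
    · simp [(hp e).1 he, Matrix.mulVec_smul]
    · simp [(hp e).2 he, Matrix.mulVec_smul, Finset.smul_sum]
    · simp [hpd t ht s hs, Matrix.mulVec_smul, Finset.smul_sum]

theorem HasFractionalSolution.exists_isGlobalSolution (h : N.HasFractionalSolution F k n) :
    ∃ Y : N.E → (N.V → Fin k → F) →ₗ[F] (Fin n → F), N.IsGlobalSolution Y := by
  obtain ⟨C, hC⟩ := h
  obtain ⟨Y, hY⟩ := exists_linearMap_forall_prodMk_mem C.solutions hC
  have sum_eq_zero {m : ℕ} {v : N.V} (M : N.E → Matrix (Fin m) (Fin n) F)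
      (X : N.V → Fin k → F) (hX : ∀ e, N.head e = v → Y X e = 0) :
      ∑ e ∈ N.inEdges v, M e *ᵥ Y X e = 0 :=
    Finset.sum_eq_zero fun e he => by rw [hX e (mem_inEdges.1 he), Matrix.mulVec_zero]
  refine ⟨fun e => LinearMap.proj e ∘ₗ Y, fun e X he hX => ?_, fun e X he hX => ?_,
    fun t ht s hs X hX => ?_⟩
  · simpa [hX] using ((hY X).1 e).1 he
  · exact (((hY X).1 e).2 he).trans (sum_eq_zero _ X hX)
  · exact ((hY X).2 t ht s hs).trans (sum_eq_zero _ X hX)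

theorem exists_matrix_eq_sum_inEdges {V : Type*} [AddCommGroup V] [Module F V] {m : ℕ}
    (v : N.V) (Y : N.E → V →ₗ[F] (Fin n → F)) (g : V →ₗ[F] (Fin m → F))
    (hg : ∀ x, (∀ e, N.head e = v → Y e x = 0) → g x = 0) :
    ∃ M : N.E → Matrix (Fin m) (Fin n) F, ∀ x, g x = ∑ e ∈ N.inEdges v, M e *ᵥ Y e x := by
  obtain ⟨G, hG⟩ := exists_eq_sum_comp_of_forall_eq_zero (N.inEdges v) Y g
    fun x hx => hg x fun e he => hx e (mem_inEdges.2 he)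
  exact ⟨fun e => LinearMap.toMatrix' (G e), by simpa [LinearMap.toMatrix'_mulVec] using hG⟩

theorem IsGlobalSolution.hasFractionalSolution
    {Y : N.E → (N.V → Fin k → F) →ₗ[F] (Fin n → F)} (hY : N.IsGlobalSolution Y) :
    N.HasFractionalSolution F k n := by
  have hsource (e : N.E) (he : N.tail e ∈ N.sources) :
      ∃ M : Matrix (Fin n) (Fin k) F, ∀ X, Y e X = M *ᵥ X (N.tail e) := by
    obtain ⟨G, hG⟩ := exists_comp_eq_of_ker_le_ker
      (LinearMap.proj (R := F) (φ := fun _ => Fin k → F) (N.tail e)) (Y e)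
      fun X hX => hY.source e X he hX
    exact ⟨LinearMap.toMatrix' G, fun X => by rw [← hG, LinearMap.toMatrix'_mulVec]; rfl⟩
  have hrelay (e : N.E) (he : N.tail e ∉ N.sources) :=
    exists_matrix_eq_sum_inEdges (N.tail e) Y (Y e) fun X => hY.relay e X he
  have hdecode (t : N.V) (ht : t ∈ N.terminals) (s : N.V) (hs : s ∈ N.demand t) :=
    exists_matrix_eq_sum_inEdges t Y (LinearMap.proj (R := F) (φ := fun _ => Fin k → F) s)
      (hY.decode t ht s hs)
  choose! A hA using hsource
  choose! A' hA' using hrelay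
  choose! B hB using hdecode
  exact ⟨⟨A, fun e' e => A' e e', B⟩, fun X => ⟨fun e => Y e X,
    fun e => ⟨fun he => hA e he X, fun he => hA' e he X⟩, fun t ht s hs => hB t ht s hs X⟩⟩

end Network

/-- A blueprint for a multiple-unicast network with a message for every element of `M` and a
bottleneck for every element of `B`: the messages that enter a bottleneck, the bottlenecks that
the terminal of a message sees, and the messages that this terminal gets as side information. -/
structure BottleneckShape (M B : Type) where
  enters : M → B → Prop
  sees : M → B → Prop
  side : M → M → Prop

namespace BottleneckShape

variable {M B I J : Type}

/-- The contents `f b` of the bottlenecks, as functions of the messages, solve the shape: every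
bottleneck depends only on the messages entering it, and every terminal can recover its message. As
in `Network.IsGlobalSolution`, both are expressed by kernels. -/
structure IsSolution {R W U : Type*} [Semiring R] [AddCommMonoid W] [Module R W] [AddCommMonoid U]
    [Module R U] (D : BottleneckShape M B) (f : B → (M → W) →ₗ[R] U) : Prop where
  eq_zero : ∀ b x, (∀ s, D.enters s b → x s = 0) → f b x = 0
  decode : ∀ s x, (∀ b, D.sees s b → f b x = 0) → (∀ s', D.side s s' → x s' = 0) → x s = 0

/-- The nodes of the network of a shape, in which every message is split among sources indexed by
`I`. Since a network has no parallel edges, the `J`-fold edges leaving the sources and forming the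
bottlenecks are subdivided by relays. -/
inductive Node (M B I J : Type) : Type
  | source (s : M) (i : I)
  | sourceRelay (s : M) (i : I) (j : J)
  | merge (b : B)
  | relay (b : B) (j : J)
  | terminal (s : M) (i : I)
  deriving Fintype

namespace Node

/-- A rank function on the nodes that increases along the edges, so that the network is acyclic. -/
def layer : Node M B I J → ℕ
  | source _ _ => 0
  | sourceRelay _ _ _ => 1
  | merge _ => 2
  | relay _ _ => 3
  | terminal _ _ => 4

/-- The demand function of the network of a shape: the terminal of a message demands it. -/
def demand : Node M B I J → Finset (Node M B I J)
  | terminal s i => {source s i}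
  | _ => ∅

end Node

open Node

/-- The adjacency relation of the network of a shape. -/
inductive Adj (D : BottleneckShape M B) : Node M B I J → Node M B I J → Prop
  | source (s i j) : Adj D (source s i) (sourceRelay s i j)
  | enters (s i j b) : D.enters s b → Adj D (sourceRelay s i j) (merge b)
  | merge (b j) : Adj D (merge b) (relay b j)
  | sees (s i b j) : D.sees s b → Adj D (relay b j) (terminal s i)
  | side (s i s' i' j) : D.side s s' → Adj D (sourceRelay s' i' j) (terminal s i)

theorem Adj.layer_lt {D : BottleneckShape M B} {u v : Node M B I J} (h : D.Adj u v) :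
    u.layer < v.layer := by
  cases h <;> simp [layer]

theorem layer_lt_of_transGen_adj {D : BottleneckShape M B} {u v : Node M B I J}
    (h : Relation.TransGen D.Adj u v) : u.layer < v.layer := by
  induction h with
  | single h => exact h.layer_lt
  | tail _ h ih => exact ih.trans h.layer_lt

variable [Fintype M] [Fintype B] [Fintype I] [Fintype J] [Nonempty M] [Nonempty I]

variable (I J) in
open Classical in
/-- The network of a shape, with sources and terminals indexed by `M × I` and with bottlenecks
consisting of `J` parallel paths. -/
noncomputable def network (D : BottleneckShape M B) : Network where
  V := Node M B I J
  E := {p : Node M B I J × Node M B I J // D.Adj p.1 p.2}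
  tail e := e.1.1
  head e := e.1.2
  edge_ext _ _ h h' := Subtype.ext (Prod.ext h h')
  acyclic v h := by
    refine (layer_lt_of_transGen_adj (D := D) (Relation.TransGen.mono ?_ _ _ h)).false
    rintro _ _ ⟨e, rfl, rfl⟩
    exact e.2
  sources := {v | ∃ s i, v = source s i}
  terminals := {v | ∃ s i, v = terminal s i}
  sources_nonempty := ⟨source (Classical.arbitrary M) (Classical.arbitrary I), by simp⟩
  disjoint_sources_terminals := by
    rw [Finset.disjoint_filter]
    rintro _ _ ⟨s, i, rfl⟩ ⟨s', i', ⟨⟩⟩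
  head_notMem_sources := by
    rintro ⟨⟨u, v⟩, h⟩ hv
    obtain ⟨s, i, rfl⟩ := (Finset.mem_filter.1 hv).2
    cases h
  tail_notMem_terminals := by
    rintro ⟨⟨u, v⟩, h⟩ hv
    obtain ⟨s, i, rfl⟩ := (Finset.mem_filter.1 hv).2
    cases h
  demand := Node.demand
  demand_subset t ht := by
    obtain ⟨s, i, rfl⟩ := (Finset.mem_filter.1 ht).2
    simp [Node.demand]

variable {D : BottleneckShape M B}

theorem mem_sources_network {v : Node M B I J} :
    v ∈ (D.network I J).sources ↔ ∃ s i, v = source s i := by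
  classical exact Finset.mem_filter_univ v

theorem mem_terminals_network {v : Node M B I J} :
    v ∈ (D.network I J).terminals ↔ ∃ s i, v = terminal s i := by
  classical exact Finset.mem_filter_univ v

theorem mem_demand_terminal {s : M} {i : I} {v : Node M B I J} :
    v ∈ (D.network I J).demand (terminal s i) ↔ v = source s i :=
  Finset.mem_singleton

variable (I J D) in
theorem isMultipleUnicast_network : (D.network I J).IsMultipleUnicast := by
  refine ⟨fun t ht => ?_, fun v hv => ?_⟩
  · obtain ⟨s, i, rfl⟩ := mem_terminals_network.1 ht
    exact ⟨source s i, mem_sources_network.2 ⟨s, i, rfl⟩, rfl⟩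
  · obtain ⟨s, i, rfl⟩ := mem_sources_network.1 hv
    refine ⟨terminal s i, ⟨mem_terminals_network.2 ⟨s, i, rfl⟩, mem_demand_terminal.2 rfl⟩, ?_⟩
    rintro t ⟨ht, hs⟩
    obtain ⟨s', i', rfl⟩ := mem_terminals_network.1 ht
    cases mem_demand_terminal.1 hs
    rfl

/-- The edge of the network of a shape between two adjacent nodes. -/
def Adj.edge {u v : Node M B I J} (h : D.Adj u v) : (D.network I J).E := ⟨(u, v), h⟩

variable {R W U : Type*} [Semiring R] [AddCommMonoid W] [Module R W] [AddCommMonoid U] [Module R U]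

section GlobalSolution

variable {Y : (D.network I J).E → (Node M B I J → W) →ₗ[R] U}
  (hY : (D.network I J).IsGlobalSolution Y) {X : Node M B I J → W}

include hY

theorem apply_edge_eq_zero {u v : Node M B I J} (h : D.Adj u v) (hu : ∀ s i, u ≠ source s i)
    (hX : ∀ w (h' : D.Adj w u), Y h'.edge X = 0) : Y h.edge X = 0 := by
  refine hY.relay h.edge X (fun hmem => ?_) ?_
  · obtain ⟨s, i, hs⟩ := mem_sources_network.1 hmem
    exact hu s i hs
  · rintro ⟨⟨w, _⟩, h'⟩ rfl
    exact hX w h'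

theorem apply_edge_sourceRelay_eq_zero {s : M} {i : I} {j : J} {v : Node M B I J}
    (h : D.Adj (sourceRelay s i j) v) (hX : X (source s i) = 0) : Y h.edge X = 0 := by
  refine apply_edge_eq_zero hY h (by simp) fun w h' => ?_
  cases h'
  exact hY.source _ X (mem_sources_network.2 ⟨s, i, rfl⟩) hX

theorem apply_edge_merge_eq_zero {b : B} {j : J}
    (hX : ∀ s i, D.enters s b → X (source s i) = 0) :
    Y (Adj.merge b j : D.Adj _ _).edge X = 0 := by
  refine apply_edge_eq_zero hY _ (by simp) fun w h' => ?_
  cases h' with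
  | enters s i j _ hs => exact apply_edge_sourceRelay_eq_zero hY _ (hX s i hs)

theorem apply_source_eq_zero {s : M}
    (hsees : ∀ b j, D.sees s b → Y (Adj.merge b j : D.Adj _ _).edge X = 0)
    (hside : ∀ s' i, D.side s s' → X (source s' i) = 0) (i : I) : X (source s i) = 0 := by
  refine hY.decode (terminal s i) (mem_terminals_network.2 ⟨s, i, rfl⟩) _
    (mem_demand_terminal.2 rfl) X ?_
  rintro ⟨⟨u, _⟩, h⟩ rfl
  cases h with
  | side _ _ s' i' j hs =>
    exact apply_edge_sourceRelay_eq_zero hY (.side s i s' i' j hs) (hside s' i' hs)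
  | sees _ _ b j hb =>
    refine apply_edge_eq_zero hY (.sees s i b j hb) (by simp) fun w h' => ?_
    cases h'
    exact hsees b j hb

end GlobalSolution

theorem exists_isSolution_of_isGlobalSolution {Y : (D.network I J).E → (Node M B I J → W) →ₗ[R] U}
    (hY : (D.network I J).IsGlobalSolution Y) :
    ∃ f : B → (M → I → W) →ₗ[R] (J → U), D.IsSolution f := by
  let X : (M → I → W) →ₗ[R] (Node M B I J → W) := LinearMap.pi fun
    | source s i => LinearMap.proj i ∘ₗ LinearMap.proj s
    | _ => 0
  refine ⟨fun b => LinearMap.pi fun j => Y (Adj.merge b j : D.Adj _ _).edge ∘ₗ X,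
    fun b x hx => funext fun j => ?_, fun s x hb hs => funext fun i => ?_⟩
  · exact apply_edge_merge_eq_zero hY fun s i hs => congrFun (hx s hs) i
  · exact apply_source_eq_zero hY (X := X x) (fun b j hb' => congrFun (hb b hb') j)
      (fun s' i' hs' => congrFun (hs s' hs') i') i

/-- The content of an edge of the network of a shape when the edges at the source relays carry the
coordinates of `g` applied to the messages, and those at the relays of a bottleneck `b` carry the
coordinates of `f b`. It is `0` on pairs of nodes that are not adjacent. -/
def edgeContent (g : W →ₗ[R] (J → U)) (f : B → (M → I → W) →ₗ[R] (J → U)) :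
    Node M B I J → Node M B I J → (Node M B I J → W) →ₗ[R] U
  | sourceRelay s i j, _ | source _ _, sourceRelay s i j =>
    LinearMap.proj j ∘ₗ g ∘ₗ LinearMap.proj (source s i)
  | relay b j, _ | merge _, relay b j =>
    LinearMap.proj j ∘ₗ f b ∘ₗ
      LinearMap.pi fun s => LinearMap.pi fun i => LinearMap.proj (source s i)
  | _, _ => 0

theorem IsSolution.isGlobalSolution_edgeContent {g : W →ₗ[R] (J → U)} (hg : Function.Injective g)
    {f : B → (M → I → W) →ₗ[R] (J → U)} (hf : D.IsSolution f) :
    (D.network I J).IsGlobalSolution fun e => edgeContent g f e.1.1 e.1.2 := by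
  have recover {w : W} (hw : ∀ j, g w j = 0) : w = 0 :=
    hg ((funext hw).trans (map_zero g).symm)
  refine ⟨?_, ?_, ?_⟩
  · rintro ⟨⟨u, v⟩, h⟩ X hu hX
    obtain ⟨s, i, rfl⟩ := mem_sources_network.1 hu
    cases h with
    | source _ _ j => exact congrFun ((congrArg g hX).trans (map_zero g)) j
  · rintro ⟨⟨u, v⟩, h⟩ X hu hX
    cases h with
    | source s i j => exact absurd (mem_sources_network.2 ⟨s, i, rfl⟩) hu
    | enters s i j b h => exact hX (Adj.source s i j).edge rfl
    | side s i s' i' j h => exact hX (Adj.source s' i' j).edge rfl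
    | sees s i b j h => exact hX (Adj.merge b j).edge rfl
    | merge b j =>
      refine congrFun (hf.eq_zero b (fun s i => X (source s i)) fun s hs => funext fun i => ?_) j
      exact recover fun j => hX (Adj.enters s i j b hs).edge rfl
  · intro t ht v hv X hX
    obtain ⟨s, i, rfl⟩ := mem_terminals_network.1 ht
    obtain rfl := mem_demand_terminal.1 hv
    refine congrFun (hf.decode s (fun s i => X (source s i)) (fun b hb => funext fun j => ?_)
      fun s' hs' => funext fun i' => recover fun j => ?_) i
    · exact hX (Adj.sees s i b j hb).edge rfl
    · exact hX (Adj.side s i s' i' j hs').edge rfl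

variable (I J) in
theorem hasFractionalSolution_network_iff {F : Type*} [Field F] {a c : ℕ}
    (hac : a ≤ Fintype.card J * c) :
    (D.network I J).HasFractionalSolution F a c ↔
      ∃ f : B → (M → I → Fin a → F) →ₗ[F] (J → Fin c → F), D.IsSolution f := by
  constructor
  · intro h
    obtain ⟨Y, hY⟩ := h.exists_isGlobalSolution
    exact exists_isSolution_of_isGlobalSolution hY
  · rintro ⟨f, hf⟩
    obtain ⟨g, hg⟩ : ∃ g : (Fin a → F) →ₗ[F] (J → Fin c → F), Function.Injective g := by
      rw [← finrank_le_iff_exists_linearMap]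
      simpa [Module.finrank_pi_fintype] using hac
    exact (hf.isGlobalSolution_edgeContent hg).hasFractionalSolution

end BottleneckShape

section OmitSum

variable {ι : Type*} [Fintype ι]

/-- The sum of all coordinates (`none`), or of all coordinates but the `i`-th one (`some i`). These
are the contents of the bottlenecks of `charShape` in suitable coordinates. -/
def omitSum (R U : Type*) [Ring R] [AddCommGroup U] [Module R U] :
    Option ι → (ι → U) →ₗ[R] U
  | none => ∑ j, LinearMap.proj j
  | some i => ∑ j, LinearMap.proj j - LinearMap.proj i

section Ring

variable {R U : Type*} [Ring R] [AddCommGroup U] [Module R U]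

@[simp]
theorem omitSum_none (y : ι → U) : omitSum R U none y = ∑ j, y j := by
  simp [omitSum]

@[simp]
theorem omitSum_some (i : ι) (y : ι → U) : omitSum R U (some i) y = ∑ j, y j - y i := by
  simp [omitSum]

theorem omitSum_some_eq_zero {i : ι} {y : ι → U} (hy : ∀ j, j ≠ i → y j = 0) :
    omitSum R U (some i) y = 0 := by
  rw [omitSum_some, Fintype.sum_eq_single i hy, sub_self]

end Ring

variable {F U : Type*} [Field F] [AddCommGroup U] [Module F U] [Nontrivial U]

variable (ι) in
theorem omitSum_none_eq_zero_of_some_iff :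
    (∀ y : ι → U, (∀ i, omitSum F U (some i) y = 0) → omitSum F U none y = 0) ↔
      (Fintype.card ι : F) ≠ 1 := by
  refine ⟨fun h hcard => ?_, fun hcard y hy => ?_⟩
  · obtain ⟨v, hv⟩ := exists_ne (0 : U)
    have hsum : ∑ _j : ι, v = v := by simp [← Nat.cast_smul_eq_nsmul F, hcard]
    exact hv (hsum ▸ by simpa using h (fun _ => v) (by simp [hsum]))
  · have hy' (i : ι) : y i = ∑ j, y j := (sub_eq_zero.1 (omitSum_some (R := F) i y ▸ hy i)).symm
    have hsum : ((Fintype.card ι : F) - 1) • ∑ j, y j = 0 := by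
      rw [sub_smul, one_smul, sub_eq_zero, Nat.cast_smul_eq_nsmul]
      conv_rhs => rw [Finset.sum_congr rfl fun i _ => hy' i]
      simp
    simpa [sub_ne_zero.2 hcard] using hsum

theorem omitSum_some_eq_zero_of_ne_iff (i₀ : ι) :
    (∀ y : ι → U, (∀ i, i ≠ i₀ → omitSum F U (some i) y = 0) → omitSum F U (some i₀) y = 0) ↔
      (Fintype.card ι : F) = 1 := by
  classical
  have sum_eq {y : ι → U} {v : U} (hy : ∀ i, i ≠ i₀ → y i = v) :
      ∑ j, y j - y i₀ = ((Fintype.card ι : F) - 1) • v := by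
    have hcard : 1 ≤ Fintype.card ι := Fintype.card_pos_iff.2 ⟨i₀⟩
    rw [← Finset.sum_erase_eq_sub (Finset.mem_univ i₀),
      Finset.sum_congr rfl fun i hi => hy i (Finset.ne_of_mem_erase hi)]
    simp [← Nat.cast_smul_eq_nsmul F, hcard]
  refine ⟨fun h => ?_, fun hcard y hy => ?_⟩
  · obtain ⟨v, hv⟩ := exists_ne (0 : U)
    -- the coordinate at `i₀` is chosen so that the sum of all coordinates is `v`
    let y : ι → U := Function.update (fun _ => v) i₀ (v - ((Fintype.card ι : F) - 1) • v)
    have hy (i : ι) (hi : i ≠ i₀) : y i = v := by simp [y, hi]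
    have hsum : ∑ j, y j = v := by
      rw [sub_eq_iff_eq_add.1 (sum_eq hy)]
      simp [y]
    have := h y fun i hi => by simp [hsum, hy i hi]
    rw [omitSum_some, sum_eq hy, smul_eq_zero_iff_left hv] at this
    exact sub_eq_zero.1 this
  · have hy' (i : ι) (hi : i ≠ i₀) : y i = ∑ j, y j :=
      (sub_eq_zero.1 (omitSum_some (R := F) i y ▸ hy i hi)).symm
    rw [omitSum_some, sum_eq hy', hcard, sub_self, zero_smul]

theorem omitSum_eq_zero_of_some_ne_iff (b₀ : Option ι) :
    (∀ y : ι → U, (∀ i, some i ≠ b₀ → omitSum F U (some i) y = 0) → omitSum F U b₀ y = 0) ↔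
      (b₀ = none ↔ (Fintype.card ι : F) ≠ 1) := by
  cases b₀ with
  | none => simpa using omitSum_none_eq_zero_of_some_iff ι
  | some i₀ => simpa using omitSum_some_eq_zero_of_ne_iff i₀

end OmitSum

section Recover

variable {F W U : Type*} [Field F] [AddCommGroup W] [Module F W] [FiniteDimensional F W]
  [AddCommGroup U] [Module F U] [FiniteDimensional F U]

theorem apply_eq_zero_iff_of_recover (hdim : Module.finrank F W = Module.finrank F U) {ι : Type*}
    [DecidableEq ι] {c b : (ι → W) →ₗ[F] U} {i j : ι} (hij : j ≠ i)
    (hci : Function.Injective fun w => c (Pi.single i w))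
    (hcj : Function.Injective fun w => c (Pi.single j w)) (hb : ∀ w, b (Pi.single i w) = 0)
    (hdec : ∀ x, c x = 0 → b x = 0 → x i = 0) (x : ι → W) :
    b x = 0 ↔ c x = c (Pi.single i (x i)) := by
  have surj {f : (ι → W) →ₗ[F] U} {k : ι} (h : Function.Injective fun w => f (Pi.single k w)) :
      Function.Surjective fun w => f (Pi.single k w) :=
    (LinearMap.injective_iff_surjective_of_finrank_eq_finrank hdim
      (f := f ∘ₗ LinearMap.single F (fun _ => W) k)).1 h
  have apply_eq {x : ι → W} (hx : b x = 0) : c x = c (Pi.single i (x i)) := by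
    obtain ⟨w, hw : c (Pi.single i w) = c x⟩ := surj hci (c x)
    have hxi := hdec (x - Pi.single i w) (by simp [hw]) (by simp [hx, hb])
    rw [Pi.sub_apply, Pi.single_eq_same, sub_eq_zero] at hxi
    rw [hxi, hw]
  refine ⟨apply_eq, fun hx => ?_⟩
  have hbj : Function.Injective fun w => b (Pi.single j w) := by
    refine (injective_iff_map_eq_zero (b ∘ₗ LinearMap.single F (fun _ => W) j)).2 fun w hw => hcj ?_
    simpa [hij.symm] using apply_eq hw
  obtain ⟨w, hw : b (Pi.single j w) = b x⟩ := surj hbj (b x)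
  have hcw : c (Pi.single j w) = 0 := by
    have := apply_eq (x := x - Pi.single j w) (by simp [hw])
    simpa [hij.symm, hx] using this
  have : w = 0 := hcj (by simpa using hcw)
  rw [← hw, this, Pi.single_zero, map_zero]

theorem exists_linearEquiv_apply_eq_zero_iff_omitSum
    (hdim : Module.finrank F W = Module.finrank F U) {ι : Type*} [Fintype ι] [Nontrivial ι]
    {f : Option ι → (ι → W) →ₗ[F] U}
    (hf : ∀ i x, (∀ j, j ≠ i → x j = 0) → f (some i) x = 0)
    (hdec : ∀ i x, f none x = 0 → f (some i) x = 0 → x i = 0) :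
    ∃ Φ : (ι → W) ≃ₗ[F] (ι → U), ∀ b x, f b x = 0 ↔ omitSum F U b (Φ x) = 0 := by
  classical
  have hsingle (i : ι) (w : W) : f (some i) (Pi.single i w) = 0 :=
    hf i _ fun j hj => by simp [hj]
  have hinj (i : ι) : Function.Injective (f none ∘ₗ LinearMap.single F (fun _ => W) i) :=
    (injective_iff_map_eq_zero _).2 fun w hw => by
      simpa using hdec i (Pi.single i w) hw (hsingle i w)
  let Φ : (ι → W) ≃ₗ[F] (ι → U) :=
    LinearEquiv.piCongrRight fun i => LinearMap.linearEquivOfInjective _ (hinj i) hdim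
  have hΦ (x : ι → W) (i : ι) : Φ x i = f none (Pi.single i (x i)) := rfl
  have hsum (x : ι → W) : ∑ j, Φ x j = f none x := by
    simp only [hΦ, ← map_sum, Finset.univ_sum_single]
  refine ⟨Φ, ?_⟩
  rintro (_ | i) x
  · rw [omitSum_none, hsum]
  · obtain ⟨j, hj⟩ := exists_ne i
    rw [omitSum_some, hsum, hΦ, sub_eq_zero]
    exact apply_eq_zero_iff_of_recover hdim hj (hinj i) (hinj j) (hsingle i) (hdec i) x

end Recover

namespace BottleneckShape

variable {ι : Type}

/-- The shape whose solvability depends on the characteristic. The bottleneck `none` is entered by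
all messages `some j`, the bottleneck `some i` by those with `j ≠ i`, and from these two and the
message `none` the message `some i` has to be recovered. The message `none` enters the bottleneck
`b₀`, and has to be recovered from this one and all the bottlenecks `some i`. -/
def charShape (b₀ : Option ι) : BottleneckShape (Option ι) (Option ι) where
  enters
    | some _, none => True
    | some j, some i => j ≠ i
    | none, b => b = b₀
  sees
    | some i, b => b = none ∨ b = some i
    | none, b => b = b₀ ∨ b ≠ none
  side
    | some _, s => s = none
    | none, _ => False

variable {F W U : Type*} [Field F] [AddCommGroup W] [Module F W] [AddCommGroup U] [Module F U]
  {b₀ : Option ι}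

/-- The messages of `charShape` in which the message `none` is zero. -/
def extendSome (R W ι : Type*) [Semiring R] [AddCommMonoid W] [Module R W] :
    (ι → W) →ₗ[R] (Option ι → W) :=
  LinearMap.pi fun s => s.elim 0 LinearMap.proj

/-- Recovering the message `none` makes the bottleneck `b₀` carry a copy of it, so on messages with
`x none = 0` the content of `b₀` has to be a function of the contents of the other bottlenecks. -/
theorem IsSolution.apply_extendSome_eq_zero [FiniteDimensional F W] [FiniteDimensional F U]
    (hdim : Module.finrank F W = Module.finrank F U) {f : Option ι → (Option ι → W) →ₗ[F] U}
    (hf : (charShape b₀).IsSolution f) {x : ι → W}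
    (hx : ∀ i, some i ≠ b₀ → f (some i) (extendSome F W ι x) = 0) :
    f b₀ (extendSome F W ι x) = 0 := by
  classical
  let single : W →ₗ[F] (Option ι → W) := LinearMap.single F (fun _ => W) none
  have hsingle (b : Option ι) (hb : b ≠ b₀) (w : W) : f b (single w) = 0 := by
    refine hf.eq_zero b _ ?_
    rintro (_ | j) hs
    · exact absurd hs hb
    · simp [single]
  have decode_none (z : Option ι → W) (hb₀ : f b₀ z = 0)
      (hz : ∀ i, some i ≠ b₀ → f (some i) z = 0) : z none = 0 := by
    refine hf.decode none z ?_ fun _ hs => hs.elim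
    intro b hb
    by_cases h : b = b₀
    · rwa [h]
    · obtain ⟨i, rfl⟩ := Option.ne_none_iff_exists'.1 (hb.resolve_left h)
      exact hz i h
  have hinj : Function.Injective (f b₀ ∘ₗ single) :=
    (injective_iff_map_eq_zero _).2 fun w hw => by
      simpa [single] using decode_none (single w) hw fun i hi => hsingle _ hi w
  obtain ⟨w, hw : f b₀ (single w) = f b₀ (extendSome F W ι x)⟩ :=
    (LinearMap.injective_iff_surjective_of_finrank_eq_finrank hdim).1 hinj _
  have : w = 0 := by
    simpa [single, extendSome] using decode_none (extendSome F W ι x - single w) (by simp [hw])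
      fun i hi => by rw [map_sub, hx i hi, hsingle _ hi, sub_zero]
  rw [← hw, this, map_zero, map_zero]

variable [Fintype ι]

theorem IsSolution.eq_none_iff_card_ne_one [FiniteDimensional F W] [FiniteDimensional F U]
    [Nontrivial U] [Nontrivial ι] (hdim : Module.finrank F W = Module.finrank F U)
    {f : Option ι → (Option ι → W) →ₗ[F] U} (hf : (charShape b₀).IsSolution f) :
    b₀ = none ↔ (Fintype.card ι : F) ≠ 1 := by
  obtain ⟨Φ, hΦ⟩ := exists_linearEquiv_apply_eq_zero_iff_omitSum hdim
    (f := fun b => f b ∘ₗ extendSome F W ι)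
    (fun i x hx => hf.eq_zero _ _ <| by
      rintro (_ | j) hs
      · rfl
      · exact hx j hs)
    (fun i x hnone hsome => hf.decode (some i) (extendSome F W ι x)
      (by rintro b (rfl | rfl) <;> assumption) (by rintro _ rfl; rfl))
  refine (omitSum_eq_zero_of_some_ne_iff (U := U) b₀).1 fun y hy => ?_
  have hf_symm (b : Option ι) :
      f b (extendSome F W ι (Φ.symm y)) = 0 ↔ omitSum F U b y = 0 := by
    simpa using hΦ b (Φ.symm y)
  exact (hf_symm b₀).1 <| hf.apply_extendSome_eq_zero hdim fun i hi => (hf_symm _).2 (hy i hi)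

open Classical in
/-- The contents of the bottlenecks in the solution of `charShape`. -/
noncomputable def charContent (e : W ≃ₗ[F] U) (b₀ b : Option ι) : (Option ι → W) →ₗ[F] U :=
  e ∘ₗ (omitSum F W b ∘ₗ LinearMap.funLeft F W some + if b = b₀ then LinearMap.proj none else 0)

theorem charContent_eq_zero_iff {e : W ≃ₗ[F] U} {b : Option ι} {x : Option ι → W}
    (hx : b = b₀ → x none = 0) :
    charContent e b₀ b x = 0 ↔ omitSum F W b (fun j => x (some j)) = 0 := by
  rw [charContent, LinearMap.comp_apply, LinearEquiv.coe_coe, e.map_eq_zero_iff]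
  split_ifs with h
  · simp [hx h, LinearMap.funLeft, Function.comp_def]
  · simp [LinearMap.funLeft, Function.comp_def]

theorem charContent_self_eq_zero_iff {e : W ≃ₗ[F] U} {x : Option ι → W}
    (hx : omitSum F W b₀ (fun j => x (some j)) = 0) :
    charContent e b₀ b₀ x = 0 ↔ x none = 0 := by
  simp [charContent, LinearMap.funLeft, Function.comp_def, hx]

theorem isSolution_charContent [Nontrivial W] (e : W ≃ₗ[F] U)
    (h : b₀ = none ↔ (Fintype.card ι : F) ≠ 1) :
    (charShape b₀).IsSolution (charContent e b₀) := by
  refine ⟨fun b x hx => (charContent_eq_zero_iff (hx none)).2 ?_, ?_⟩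
  · cases b with
    | none => simp [show ∀ j, x (some j) = 0 from fun j => hx (some j) trivial]
    | some i => exact omitSum_some_eq_zero fun j hj => hx (some j) hj
  rintro (_ | i) x hb hs
  · have hne (i : ι) (hi : some i ≠ b₀) : omitSum F W (some i) (fun j => x (some j)) = 0 :=
      (charContent_eq_zero_iff (absurd · hi)).1 (hb (some i) (.inr (Option.some_ne_none i)))
    have hb₀ := (omitSum_eq_zero_of_some_ne_iff (U := W) b₀).2 h _ hne
    exact (charContent_self_eq_zero_iff hb₀).1 (hb b₀ (.inl rfl))
  · have hx : x none = 0 := hs none rfl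
    have hnone := (charContent_eq_zero_iff fun _ => hx).1 (hb none (.inl rfl))
    have hsome := (charContent_eq_zero_iff fun _ => hx).1 (hb (some i) (.inr rfl))
    rw [omitSum_none] at hnone
    simpa [hnone] using hsome

theorem hasFractionalSolution_network_charShape_iff [Nontrivial ι] {I J : Type} [Fintype I]
    [Fintype J] [Nonempty I] [Nonempty J] {a c : ℕ} (ha : 0 < a)
    (hac : Fintype.card I * a = Fintype.card J * c) :
    ((charShape b₀).network I J).HasFractionalSolution F a c ↔
      (b₀ = none ↔ (Fintype.card ι : F) ≠ 1) := by
  have hdim : Module.finrank F (I → Fin a → F) = Module.finrank F (J → Fin c → F) := by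
    simpa [Module.finrank_pi_fintype] using hac
  have hle : a ≤ Fintype.card J * c := hac ▸ Nat.le_mul_of_pos_left a Fintype.card_pos
  have : Nonempty (Fin a) := ⟨⟨0, ha⟩⟩
  have e := LinearEquiv.ofFinrankEq (I → Fin a → F) (J → Fin c → F) hdim
  have : Nontrivial (J → Fin c → F) := e.symm.toEquiv.nontrivial
  rw [hasFractionalSolution_network_iff I J hle]
  exact ⟨fun ⟨f, hf⟩ => hf.eq_none_iff_card_ne_one hdim,
    fun h => ⟨_, isSolution_charContent e h⟩⟩

end BottleneckShape

theorem natCast_prod_eq_zero_iff_ringChar_mem {R : Type*} [CommSemiring R] [NoZeroDivisors R]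
    [Nontrivial R] {T : Finset ℕ} (hT : ∀ p ∈ T, p.Prime) :
    ((∏ p ∈ T, p : ℕ) : R) = 0 ↔ ringChar R ∈ T := by
  rw [Nat.cast_prod, Finset.prod_eq_zero_iff]
  constructor
  · rintro ⟨p, hp, hp0⟩
    rwa [CharP.ringChar_of_prime_eq_zero (hT p hp) hp0]
  · exact fun h => ⟨_, h, CharP.cast_eq_zero R _⟩

theorem exists_network_hasFractionalSolution_iff {k n q : ℕ} (hk : 0 < k) (hn : 0 < n) (hq : q ≠ 0)
    (P : Prop) :
    ∃ N : Network, N.IsMultipleUnicast ∧ ∀ (F : Type*) [Field F] (d : ℕ), 0 < d →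
      (N.HasFractionalSolution F (d * k) (d * n) ↔ (P ↔ (q : F) ≠ 0)) := by
  classical
  have : NeZero k := ⟨hk.ne'⟩
  have : NeZero n := ⟨hn.ne'⟩
  have : Nontrivial (Fin (q + 1)) := Fin.nontrivial_iff_two_le.2 (by lia)
  let b₀ : Option (Fin (q + 1)) := if P then none else some 0
  have hb₀ : b₀ = none ↔ P := by simp [b₀]
  refine ⟨(BottleneckShape.charShape b₀).network (Fin n) (Fin k),
    BottleneckShape.isMultipleUnicast_network _ _ _, fun F _ d hd => ?_⟩
  rw [BottleneckShape.hasFractionalSolution_network_charShape_iff (Nat.mul_pos hd hk)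
    (by simp only [Fintype.card_fin]; ring), hb₀]
  simp

theorem exists_finset_iff_notMem_iff_mem {S : Set ℕ} (hS : ∀ p ∈ S, p.Prime)
    (hfin : S.Finite ∨ ({p : ℕ | p.Prime} \ S).Finite) :
    ∃ T : Finset ℕ, (∀ p ∈ T, p.Prime) ∧ ∃ P : Prop, ∀ p : ℕ, p.Prime ∨ p = 0 →
      ((P ↔ p ∉ T) ↔ p ∈ S ∨ p = 0 ∧ S.Infinite) := by
  rcases hfin with h | h
  · refine ⟨h.toFinset, by simpa using hS, False, fun p _ => ?_⟩
    simp [h.not_infinite]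
  · have hinf : S.Infinite := fun hfin =>
      Nat.infinite_setOfPred_prime ((hfin.union h).subset (by simp))
    refine ⟨h.toFinset, by simp +contextual, True, ?_⟩
    rintro p (hp | rfl)
    · simp [hp, hp.ne_zero]
    · simp [hinf, Nat.not_prime_zero]

namespace Network

theorem hasRateSolution_iff_and_forall_iff {N : Network} {F : Type*} [Field F] {k n : ℕ} {P : Prop}
    (h : ∀ d : ℕ, 0 < d → (N.HasFractionalSolution F (d * k) (d * n) ↔ P)) :
    (N.HasRateSolution F k n ↔ P) ∧
      ((∀ d : ℕ, 0 < d → N.HasFractionalSolution F (d * k) (d * n)) ↔ P) :=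
  ⟨⟨fun ⟨d, hd, hsol⟩ => (h d hd).1 hsol, fun hP => ⟨1, one_pos, (h 1 one_pos).2 hP⟩⟩,
    fun hsol => (h 1 one_pos).1 (hsol 1 one_pos), fun hP d hd => (h d hd).2 hP⟩

end Network

theorem mainTheorem1_general (k n : ℕ) (hk : 0 < k) (hn : 0 < n) (S : Set ℕ)
    (hS : ∀ p ∈ S, p.Prime) (hfin : S.Finite ∨ ({p : ℕ | p.Prime} \ S).Finite) :
    ∃ N : Network, N.IsMultipleUnicast ∧
      ∀ (F : Type*) [Field F],
        (N.HasRateSolution F k n ↔ ringChar F ∈ S ∨ ringChar F = 0 ∧ S.Infinite) ∧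
        ((∀ d : ℕ, 0 < d → N.HasFractionalSolution F (d * k) (d * n)) ↔
          ringChar F ∈ S ∨ ringChar F = 0 ∧ S.Infinite) := by
  obtain ⟨T, hT, P, hP⟩ := exists_finset_iff_notMem_iff_mem hS hfin
  obtain ⟨N, hN, hsol⟩ := exists_network_hasFractionalSolution_iff hk hn
    (Finset.prod_ne_zero_iff.2 fun p hp => (hT p hp).ne_zero) P
  refine ⟨N, hN, fun F _ => Network.hasRateSolution_iff_and_forall_iff fun d hd => ?_⟩
  rw [hsol F d hd, Ne, natCast_prod_eq_zero_iff_ringChar_mem hT]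
  exact hP _ (CharP.char_is_prime_or_zero F _)

theorem mainTheorem1 (k n : ℕ) (hk : 0 < k) (hn : 0 < n) (S : Set ℕ)
    (hS : ∀ p ∈ S, p.Prime) (hfin : S.Finite ∨ ({p : ℕ | p.Prime} \ S).Finite) :
    ∃ N : Network, N.IsMultipleUnicast ∧
      ∀ (F : Type*) [Field F] [Finite F],
        (N.HasRateSolution F k n ↔ ringChar F ∈ S) ∧
        ((∀ d : ℕ, 0 < d → N.HasFractionalSolution F (d * k) (d * n)) ↔ ringChar F ∈ S) := by
  obtain ⟨N, hN, hsol⟩ := mainTheorem1_general k n hk hn S hS hfin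
  exact ⟨N, hN, fun F _ _ => by simpa [CharP.ringChar_ne_zero_of_finite F] using hsol F⟩
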